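/- All groups are second-countable locally compact Hausdorff unimodular groups, each with a fixed (two-sided invariant) Haar measure: $(G,\gamma)$, $(H,\eta)$, $(K,\kappa)$, $(L,\lambda)$. A \emph{polymorphism} $(X,\xi)\rightarrowtail(Y,\upsilon)$ of standard Borel spaces with $\sigma$-finite measures is a measure $\mu$ on $X\times Y$ whose projections to $X$ and $Y$ are dominated by $\xi$ and $\upsilon$. It has conditional measures $\mu_x$ on $Y$ ($x\in X$), determined up to a $\xi$-null set of $x$, with $\mu(A\times B)=\int_A\mu_x(B)\,d\xi(x)$. The product of $\mu:X\rightarrowtail Y$ and $\nu:Y\rightarrowtail Z$ is the polymorphism $\varkappa=\nu\mu:X\rightarrowtail Z$ with conditional measures $\varkappa_x=\int_Y\nu_y\,d\mu_x(y)$. For a subgroup $R\subset G\times H$, let $\operatorname{dom}R\subset G$ and $\operatorname{im}R\subset H$ be its projections, $\ker R=\{g:(g,1)\in R\}$ and $\operatorname{indef}R=\{h:(1,h)\in R\}$. For $R\subset G\times H$ and $T\subset H\times K$ put $TR=\{(g,k): \exists h,\ (g,h)\in R,\ (h,k)\in T\}$. A \emph{polyhomomorphism} $G\rightarrowtail H$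 is either the zero measure on $G\times H$ or a closed subgroup $R\subset G\times H$ with a fixed Haar measure $\rho$ on $R$ such that the images of $\rho$ under the projections to $G$ and $H$ are dominated by $\gamma$ and $\eta$. \textbf{Theorem.} (1) Every polyhomomorphism, regarded as a measure on $G\times H$, is a polymorphism $(G,\gamma)\rightarrowtail(H,\eta)$. (2) For every nonzero polyhomomorphism $R^\circ=(R,\rho)$ there are unique constants $\alpha(R^\circ),\beta(R^\circ)\in(0,1]$ such that the image of $\rho$ in $G$ is $\alpha(R^\circ)\,\gamma|_{\operatorname{dom}R}$ and the image of $\rho$ in $H$ is $\beta(R^\circ)\,\eta|_{\operatorname{im}R}$. (3) For nonzero polyhomomorphisms $R^\circ:G\rightarrowtail H$ and $T^\circ:H\rightarrowtail K$ the indices below are finite, and there is exactly one nonzero polyhomomorphism $S^\circ=T^\circ R^\circ:G\rightarrowtail K$ whose underlying subgroup is $TR$ and for which $$\alpha(S^\circ)=\frac{\alpha(R^\circ)\alpha(T^\circ)}{[\operatorname{indef}R:\operatorname{indef}R\cap\operatorname{dom}T]},\qquad \beta(S^\circ)=\frac{\beta(R^\circ)\beta(T^\circ)}{[\ker T:\ker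 T\cap\operatorname{im}R]}.$$ A product in which one factor is zero is defined to be zero. (4) For all polyhomomorphisms $R^\circ:G\rightarrowtail H$ and $T^\circ:H\rightarrowtail K$, the product $T^\circ R^\circ$, regarded as a polymorphism, is the product of the polymorphisms $T^\circ$ and $R^\circ$. (5) The product is associative: $(S^\circ T^\circ)R^\circ=S^\circ(T^\circ R^\circ)$ for all polyhomomorphisms $R^\circ:G\rightarrowtail H$, $T^\circ:H\rightarrowtail K$, $S^\circ:K\rightarrowtail L$. -/

import Mathlib

open MeasureTheory ProbabilityTheory
open scoped NNReal ENNReal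

/-- A second-countable locally compact Hausdorff group is a Polish space, hence it is
standard Borel. -/
instance (priority := 50) standardBorelSpace_of_locallyCompact_group
    {G : Type*} [Group G] [TopologicalSpace G] [IsTopologicalGroup G] [T2Space G]
    [LocallyCompactSpace G] [SecondCountableTopology G] [MeasurableSpace G] [BorelSpace G] :
    StandardBorelSpace G := by
  let _ : UniformSpace G := IsTopologicalGroup.rightUniformSpace G
  have : IsRightUniformGroup G := { uniformity_eq := rfl }
  have : CompleteSpace G := IsRightUniformGroup.completeSpace_of_weaklyLocallyCompactSpace
  have : (uniformity G).IsCountablyGenerated := by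
    rw [uniformity_eq_comap_nhds_one]
    infer_instance
  have : TopologicalSpace.IsCompletelyMetrizableSpace G := inferInstance
  have : PolishSpace G := {}
  infer_instance

/-! ### Polymorphisms of measure spaces -/

/-- A polymorphism `(X, ξ) ↣ (Y, υ)`: a measure on `X × Y` whose projections to `X` and `Y`
are dominated by `ξ` and `υ` respectively. -/
@[ext]
structure Polymorphism {X Y : Type*} [MeasurableSpace X] [MeasurableSpace Y]
    (ξ : Measure X) (υ : Measure Y) where
  /-- the measure on `X × Y` -/
  measure : Measure (X × Y)
  fst_le : measure.map Prod.fst ≤ ξ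
  snd_le : measure.map Prod.snd ≤ υ

namespace Polymorphism

section
variable {X Y Z : Type*} [MeasurableSpace X] [MeasurableSpace Y] [MeasurableSpace Z]
  {ξ : Measure X} {υ : Measure Y} {ζ : Measure Z}

/-- `k` is a system of conditional measures of `μ`: a measurable family `x ↦ μ_x = k x` of
measures on `Y` of total mass at most `1` such that `μ (A × B) = ∫_A μ_x(B) dξ(x)`. -/
def IsConditional (μ : Polymorphism ξ υ) (k : Kernel X Y) : Prop :=
  (∀ x, k x Set.univ ≤ 1) ∧
    ∀ (A : Set X) (B : Set Y), MeasurableSet A → MeasurableSet B →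
      μ.measure (A ×ˢ B) = ∫⁻ x in A, k x B ∂ξ

/-- Conditional measures exist. -/
theorem exists_isConditional [StandardBorelSpace Y] [SigmaFinite ξ] (μ : Polymorphism ξ υ) :
    ∃ k : Kernel X Y, μ.IsConditional k := by
  classical
  rcases isEmpty_or_nonempty Y with hY | hY
  · refine ⟨0, by simp, fun A B _ _ => ?_⟩
    have : A ×ˢ B = (∅ : Set (X × Y)) := Set.eq_empty_of_isEmpty _
    rw [this]
    simp
  obtain ⟨f, hf0, hfm, hfi⟩ :=
    exists_pos_lintegral_lt_of_sigmaFinite ξ (ε := 1) one_ne_zero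
  set m := μ.measure with hm
  have hfst : m.fst ≤ ξ := μ.fst_le
  have hfm' : Measurable fun x => (f x : ℝ≥0∞) := hfm.coe_nnreal_ennreal
  set F : X × Y → ℝ≥0∞ := fun p => f p.1 with hF
  have hFm : Measurable F := hfm'.comp measurable_fst
  set m' := m.withDensity F with hm'
  have hm'fst : m'.fst = m.fst.withDensity fun x => (f x : ℝ≥0∞) := by
    ext s hs
    rw [Measure.fst_apply hs, hm', withDensity_apply _ (measurable_fst hs),
      withDensity_apply _ hs, Measure.fst, setLIntegral_map hs hfm' measurable_fst]
  have : IsFiniteMeasure m' := by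
    refine ⟨?_⟩
    rw [← Measure.fst_univ, hm'fst, withDensity_apply _ MeasurableSet.univ,
      Measure.restrict_univ]
    exact ((lintegral_mono' hfst le_rfl).trans_lt hfi).trans ENNReal.one_lt_top
  set c := m'.condKernel with hc
  have key : ∀ (A : Set X) (B : Set Y), MeasurableSet A → MeasurableSet B →
      m (A ×ˢ B) = ∫⁻ x in A, c x B ∂m.fst := by
    intro A B hA hB
    have h1 : m = m'.withDensity (fun p => (F p)⁻¹) := by
      rw [hm', withDensity_inv_same hFm]
      · exact Filter.Eventually.of_forall fun p => by simpa [hF] using (hf0 p.1).ne'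
      · exact Filter.Eventually.of_forall fun p => by simp [hF]
    have h2 : m'.fst ⊗ₘ c = m' := m'.disintegrate c
    have hinv : Measurable fun x => (f x : ℝ≥0∞)⁻¹ := hfm'.inv
    have hcB : Measurable fun x => c x B := Kernel.measurable_coe c hB
    calc m (A ×ˢ B) = ∫⁻ p in A ×ˢ B, (F p)⁻¹ ∂(m'.fst ⊗ₘ c) := by
          rw [h2]
          conv_lhs => rw [h1]
          rw [withDensity_apply _ (hA.prod hB)]
      _ = ∫⁻ x in A, ∫⁻ _ in B, (f x : ℝ≥0∞)⁻¹ ∂(c x) ∂m'.fst :=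
          Measure.setLIntegral_compProd hFm.inv hA hB
      _ = ∫⁻ x in A, (f x : ℝ≥0∞)⁻¹ * c x B ∂m'.fst := by simp
      _ = ∫⁻ x in A, c x B ∂m.fst := by
          rw [hm'fst]
          refine (setLIntegral_withDensity_eq_setLIntegral_mul _ hfm'
            (hinv.mul hcB) hA).trans ?_
          refine lintegral_congr fun x => ?_
          have h0 : (f x : ℝ≥0∞) ≠ 0 := by simpa using (hf0 x).ne'
          simp only [Pi.mul_apply]
          rw [← mul_assoc, ENNReal.mul_inv_cancel h0 ENNReal.coe_ne_top, one_mul]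
  set g : X → ℝ≥0∞ := fun x => min (m.fst.rnDeriv ξ x) 1 with hg
  have hgm : Measurable g := (Measure.measurable_rnDeriv _ _).min measurable_const
  have : SigmaFinite m.fst := by
    refine ⟨⟨⟨spanningSets ξ, fun _ => trivial, fun i => ?_, iUnion_spanningSets ξ⟩⟩⟩
    exact (hfst _).trans_lt (measure_spanningSets_lt_top ξ i)
  have hgae : m.fst.rnDeriv ξ =ᵐ[ξ] g := by
    filter_upwards [Measure.rnDeriv_le_one_of_le hfst] with x hx
    exact (min_eq_left hx).symm
  have hgd : m.fst = ξ.withDensity g := by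
    rw [← withDensity_congr_ae hgae,
      Measure.withDensity_rnDeriv_eq _ _ (Measure.absolutelyContinuous_of_le hfst)]
  have hgm2 : Measurable (Function.uncurry fun (x : X) (_ : Y) => g x) :=
    hgm.comp measurable_fst
  have happ : ∀ (x : X) (B : Set Y),
      (c.withDensity fun x _ => g x) x B = g x * c x B := by
    intro x B
    rw [Kernel.withDensity_apply _ hgm2, withDensity_const, Measure.smul_apply, smul_eq_mul]
  refine ⟨c.withDensity fun x _ => g x, fun x => ?_, fun A B hA hB => ?_⟩
  · rw [happ, measure_univ, mul_one]
    exact min_le_right _ _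
  · rw [key A B hA hB, hgd,
      setLIntegral_withDensity_eq_setLIntegral_mul _ hgm (Kernel.measurable_coe c hB) hA]
    exact lintegral_congr fun x => (happ x B).symm

/-- A system of conditional measures `x ↦ μ_x` (unique up to null sets). -/
noncomputable def cond [StandardBorelSpace Y] [SigmaFinite ξ] (μ : Polymorphism ξ υ) :
    Kernel X Y :=
  μ.exists_isConditional.choose

theorem cond_spec [StandardBorelSpace Y] [SigmaFinite ξ] (μ : Polymorphism ξ υ) :
    μ.IsConditional μ.cond :=
  μ.exists_isConditional.choose_spec

theorem IsConditional.isFiniteKernel {μ : Polymorphism ξ υ} {k : Kernel X Y}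
    (h : μ.IsConditional k) : IsFiniteKernel k :=
  ⟨1, ENNReal.one_lt_top, h.1⟩

theorem IsConditional.bind_eq {μ : Polymorphism ξ υ} {k : Kernel X Y}
    (h : μ.IsConditional k) : ξ.bind k = μ.measure.map Prod.snd := by
  ext B hB
  rw [Measure.bind_apply hB k.aemeasurable, Measure.map_apply measurable_snd hB,
    ← Set.univ_prod, h.2 _ _ MeasurableSet.univ hB, Measure.restrict_univ]

theorem comp_apply_univ_le {μ : Polymorphism ξ υ} {ν : Polymorphism υ ζ} {k : Kernel X Y}
    {l : Kernel Y Z} (hk : μ.IsConditional k) (hl : ν.IsConditional l) (x : X) :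
    (l ∘ₖ k) x Set.univ ≤ 1 := by
  rw [Kernel.comp_apply' _ _ _ MeasurableSet.univ]
  calc ∫⁻ y, l y Set.univ ∂(k x) ≤ ∫⁻ _, 1 ∂(k x) := lintegral_mono hl.1
    _ ≤ 1 := by simpa using hk.1 x

/-- The product `ν μ : X ↣ Z` of polymorphisms `μ : X ↣ Y` and `ν : Y ↣ Z`: the measure `ϰ`
on `X × Z` with the conditional measures `ϰ_x = ∫ ν_y dμ_x(y)`. -/
noncomputable def comp [StandardBorelSpace Y] [StandardBorelSpace Z] [SigmaFinite ξ]
    [SigmaFinite υ] (ν : Polymorphism υ ζ) (μ : Polymorphism ξ υ) : Polymorphism ξ ζ where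
  measure := ξ ⊗ₘ (ν.cond ∘ₖ μ.cond)
  fst_le := by
    have := μ.cond_spec.isFiniteKernel
    have := ν.cond_spec.isFiniteKernel
    refine Measure.le_iff.2 fun A hA => ?_
    rw [Measure.map_apply measurable_fst hA, ← Set.prod_univ,
      Measure.compProd_apply_prod hA MeasurableSet.univ]
    calc _ ≤ ∫⁻ _ in A, 1 ∂ξ :=
          lintegral_mono fun x => comp_apply_univ_le μ.cond_spec ν.cond_spec x
      _ = ξ A := by simp
  snd_le := by
    have := μ.cond_spec.isFiniteKernel
    have := ν.cond_spec.isFiniteKernel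
    have h1 : (ξ ⊗ₘ (ν.cond ∘ₖ μ.cond)).map Prod.snd = (ξ.bind μ.cond).bind ν.cond := by
      rw [← Measure.snd, Measure.snd_compProd, Measure.comp_assoc]
    rw [h1, μ.cond_spec.bind_eq]
    refine le_trans ?_ (ν.cond_spec.bind_eq.trans_le ν.snd_le)
    refine Measure.le_iff.2 fun B hB => ?_
    rw [Measure.bind_apply hB ν.cond.aemeasurable, Measure.bind_apply hB ν.cond.aemeasurable]
    exact lintegral_mono' μ.snd_le le_rfl

/-- The product does not depend on the choice of the conditional measures. -/
theorem comp_measure_eq [StandardBorelSpace Y] [StandardBorelSpace Z] [SigmaFinite ξ]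
    [SigmaFinite υ] (ν : Polymorphism υ ζ) (μ : Polymorphism ξ υ) {k : Kernel X Y}
    {l : Kernel Y Z} (hk : μ.IsConditional k) (hl : ν.IsConditional l) :
    (ν.comp μ).measure = ξ ⊗ₘ (l ∘ₖ k) := by
  have aux : ∀ {k : Kernel X Y} {l : Kernel Y Z}, μ.IsConditional k → ν.IsConditional l →
      ∀ (A : Set X) (C : Set Z), MeasurableSet A → MeasurableSet C →
      (ξ ⊗ₘ (l ∘ₖ k)) (A ×ˢ C) =
        ∫⁻ y, l y C ∂((μ.measure.restrict (A ×ˢ Set.univ)).map Prod.snd) := by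
    intro k l hk hl A C hA hC
    have := hk.isFiniteKernel
    have := hl.isFiniteKernel
    have hb : (μ.measure.restrict (A ×ˢ Set.univ)).map Prod.snd = (ξ.restrict A).bind k := by
      ext B hB
      rw [Measure.map_apply measurable_snd hB, Measure.restrict_apply (measurable_snd hB),
        Measure.bind_apply hB k.aemeasurable, ← hk.2 A B hA hB]
      congr 1
      ext p
      simp [and_comm]
    rw [Measure.compProd_apply_prod hA hC, hb,
      Measure.lintegral_bind k.aemeasurable (Kernel.measurable_coe l hC).aemeasurable]
    exact lintegral_congr fun x => Kernel.comp_apply' _ _ _ hC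
  have hae : ∀ C : Set Z, MeasurableSet C →
      (fun y => ν.cond y C) =ᵐ[υ] fun y => l y C := by
    intro C hC
    refine ae_eq_of_forall_setLIntegral_eq_of_sigmaFinite (Kernel.measurable_coe _ hC)
      (Kernel.measurable_coe _ hC) fun B hB _ => ?_
    rw [← ν.cond_spec.2 B C hB hC, ← hl.2 B C hB hC]
  have hrect : ∀ (A : Set X) (C : Set Z), MeasurableSet A → MeasurableSet C →
      (ν.comp μ).measure (A ×ˢ C) = (ξ ⊗ₘ (l ∘ₖ k)) (A ×ˢ C) := by
    intro A C hA hC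
    rw [aux hk hl A C hA hC]
    refine (aux μ.cond_spec ν.cond_spec A C hA hC).trans (lintegral_congr_ae ?_)
    refine Measure.absolutelyContinuous_of_le ?_ (hae C hC)
    exact (Measure.map_mono Measure.restrict_le_self measurable_snd).trans μ.snd_le
  refine Measure.ext_of_generateFrom_of_iUnion
    (Set.image2 (· ×ˢ ·) {s : Set X | MeasurableSet s} {t : Set Z | MeasurableSet t})
    (fun n => spanningSets ξ n ×ˢ Set.univ) generateFrom_prod.symm isPiSystem_prod ?_ ?_ ?_ ?_
  · rw [← Set.iUnion_prod_const, iUnion_spanningSets, Set.univ_prod_univ]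
  · exact fun n => ⟨_, measurableSet_spanningSets ξ n, _, MeasurableSet.univ, rfl⟩
  · intro n
    refine ne_of_lt (lt_of_le_of_lt ?_ (measure_spanningSets_lt_top ξ n))
    have h := (ν.comp μ).fst_le (spanningSets ξ n)
    rwa [Measure.map_apply measurable_fst (measurableSet_spanningSets ξ n),
      ← Set.prod_univ] at h
  · rintro _ ⟨A, hA, C, hC, rfl⟩
    exact hrect A C hA hC

end

end Polymorphism

/-! ### Multiplicative relations -/

namespace MultRel

section
variable {G H K : Type*} [Group G] [Group H] [Group K]

/-- The domain of a multiplicative relation `R ⊆ G × H`: its projection to `G`. -/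
def dom (R : Subgroup (G × H)) : Subgroup G := R.map (MonoidHom.fst G H)

/-- The image of a multiplicative relation: its projection to `H`. -/
def im (R : Subgroup (G × H)) : Subgroup H := R.map (MonoidHom.snd G H)

/-- The kernel `R ∩ G` of a multiplicative relation. -/
def ker (R : Subgroup (G × H)) : Subgroup G := R.comap (MonoidHom.inl G H)

/-- The indefinity `R ∩ H` of a multiplicative relation. -/
def indef (R : Subgroup (G × H)) : Subgroup H := R.comap (MonoidHom.inr G H)

/-- The product `T R` of multiplicative relations `R : G ⇉ H` and `T : H ⇉ K`. -/
def comp (T : Subgroup (H × K)) (R : Subgroup (G × H)) : Subgroup (G × K) where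
  carrier := {p | ∃ h, (p.1, h) ∈ R ∧ (h, p.2) ∈ T}
  one_mem' := ⟨1, R.one_mem, T.one_mem⟩
  mul_mem' := by
    rintro a b ⟨h, h1, h2⟩ ⟨h', h1', h2'⟩
    exact ⟨h * h', R.mul_mem h1 h1', T.mul_mem h2 h2'⟩
  inv_mem' := by
    rintro a ⟨h, h1, h2⟩
    exact ⟨h⁻¹, R.inv_mem h1, T.inv_mem h2⟩

end

end MultRel

/-! ### Polyhomomorphisms -/

/-- A nonzero polyhomomorphism `G ↣ H`, where `γ` and `η` are the fixed Haar measures on `G`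
and `H`: a closed subgroup `R ⊆ G × H` with a Haar measure `ρ` on `R` such that the images of
`ρ` under the projections to `G` and `H` are dominated by `γ` and `η`. -/
structure HaarRelation {G H : Type*} [Group G] [TopologicalSpace G] [MeasurableSpace G]
    [Group H] [TopologicalSpace H] [MeasurableSpace H] (γ : Measure G) (η : Measure H) where
  /-- the underlying multiplicative relation -/
  rel : Subgroup (G × H)
  isClosed : IsClosed (rel : Set (G × H))
  /-- the Haar measure on the closed subgroup -/
  haar : Measure rel
  isHaar : haar.IsHaarMeasure
  fst_le : haar.map (fun r : rel => (r : G × H).1) ≤ γ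
  snd_le : haar.map (fun r : rel => (r : G × H).2) ≤ η

namespace HaarRelation

section
variable {G H K : Type*} [Group G] [TopologicalSpace G] [MeasurableSpace G]
  [Group H] [TopologicalSpace H] [MeasurableSpace H]
  [Group K] [TopologicalSpace K] [MeasurableSpace K]
  {γ : Measure G} {η : Measure H} {κ : Measure K}

/-- The image of the Haar measure of `R` in `G` is `a γ` restricted to `dom R`. -/
def IsAlpha (R : HaarRelation γ η) (a : ℝ≥0) : Prop :=
  R.haar.map (fun r : R.rel => (r : G × H).1) = a • γ.restrict (MultRel.dom R.rel : Set G)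

/-- The image of the Haar measure of `R` in `H` is `b η` restricted to `im R`. -/
def IsBeta (R : HaarRelation γ η) (b : ℝ≥0) : Prop :=
  R.haar.map (fun r : R.rel => (r : G × H).2) = b • η.restrict (MultRel.im R.rel : Set H)

/-- The constant `α(R)`: the `a` with `R.IsAlpha a`. -/
noncomputable def alpha (R : HaarRelation γ η) : ℝ≥0 := Classical.epsilon R.IsAlpha

/-- The constant `β(R)`: the `b` with `R.IsBeta b`. -/
noncomputable def beta (R : HaarRelation γ η) : ℝ≥0 := Classical.epsilon R.IsBeta

/-- `S` is the product `T R` of nonzero polyhomomorphisms: its underlying relation is the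
product of relations, and its Haar measure is normalised by
`α(S) = α(R) α(T) / [indef R : indef R ∩ dom T]` and
`β(S) = β(R) β(T) / [ker T : ker T ∩ im R]`. -/
structure IsProduct (T : HaarRelation η κ) (R : HaarRelation γ η) (S : HaarRelation γ κ) :
    Prop where
  rel_eq : S.rel = MultRel.comp T.rel R.rel
  alpha_eq : S.alpha = R.alpha * T.alpha /
    ((MultRel.indef R.rel ⊓ MultRel.dom T.rel).relIndex (MultRel.indef R.rel) : ℝ≥0)
  beta_eq : S.beta = R.beta * T.beta /
    ((MultRel.ker T.rel ⊓ MultRel.im R.rel).relIndex (MultRel.ker T.rel) : ℝ≥0)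

end

end HaarRelation

/-- A polyhomomorphism `G ↣ H`: either zero, or a closed subgroup of `G × H` with a Haar
measure whose marginals are dominated by the fixed Haar measures. -/
inductive Polyhom {G H : Type*} [Group G] [TopologicalSpace G] [MeasurableSpace G]
    [Group H] [TopologicalSpace H] [MeasurableSpace H] (γ : Measure G) (η : Measure H) where
  | zero : Polyhom γ η
  | ofRel (R : HaarRelation γ η) : Polyhom γ η

namespace Polyhom

section
variable {G H K : Type*} [Group G] [TopologicalSpace G] [MeasurableSpace G]
  [Group H] [TopologicalSpace H] [MeasurableSpace H]
  [Group K] [TopologicalSpace K] [MeasurableSpace K]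
  {γ : Measure G} {η : Measure H} {κ : Measure K}

/-- The measure on `G × H` given by a polyhomomorphism. -/
noncomputable def measure : Polyhom γ η → Measure (G × H)
  | zero => 0
  | ofRel R => R.haar.map (fun r : R.rel => (r : G × H))

/-- A polyhomomorphism considered as a polymorphism. -/
noncomputable def toPolymorphism (R : Polyhom γ η) : Polymorphism γ η where
  measure := R.measure
  fst_le := by
    cases R with
    | zero => simpa [measure] using Measure.zero_le γ
    | ofRel R =>
      simp only [measure]
      rw [Measure.map_map measurable_fst measurable_subtype_coe]
      exact R.fst_le
  snd_le := by
    cases R with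
    | zero => simpa [measure] using Measure.zero_le η
    | ofRel R =>
      simp only [measure]
      rw [Measure.map_map measurable_snd measurable_subtype_coe]
      exact R.snd_le

open Classical in
/-- The product `T R` of polyhomomorphisms. A product with zero is zero. A product of nonzero
polyhomomorphisms is the (unique) `S` with `HaarRelation.IsProduct T R S`; the value in the
case where there is no such `S` is irrelevant, since this case does not occur for unimodular
groups. -/
noncomputable def comp : Polyhom η κ → Polyhom γ η → Polyhom γ κ
  | ofRel T, ofRel R =>
    if h : ∃ S, HaarRelation.IsProduct T R S then ofRel h.choose else zero
  | zero, _ => zero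
  | ofRel _, zero => zero

end

end Polyhom

/-!
Let `R ⊆ G × H` be a closed subgroup with a Haar measure `ρ` whose images are dominated by the Haar
measures of `G` and `H`. The domination makes both projections of `R` proper
(`isProperMap_of_map_haar_le`), hence their ranges closed and their kernels compact; the ranges are
not null, so by Steinhaus' theorem they are open (`isOpen_range_of_map_haar_le`), and uniqueness of
Haar measure on an open subgroup gives the constants `α` and `β`
(`exists_map_haar_eq_smul_restrict`). Compact kernels and open domains and images make the indices
in the product formula finite.

The conditional measure of `R` at `g ∈ dom R` is `α(R)` times the invariant probability measure of
the coset `{h | (g, h) ∈ R}` of the compact group `indef R`, and it vanishes outside `dom R`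
(`exists_isCosetKernel`). This description shows that the product of the polymorphisms given by `R`
and `T` is carried by the closed subgroup `T R`, is invariant under it, and has the image
`α(R) α(T) / [indef R : indef R ∩ dom T]` times Haar measure in `dom (T R)`: an open subgroup cuts
out of a compact group a piece whose relative mass is the inverse of the index. The other image
follows by symmetry, because the product of polymorphisms may be computed with the conditional
measures in either direction (`setLIntegral_comp_eq_lintegral_mul`). Hence the product polymorphism
is itself a Haar measure of `T R` with the required constants (`HaarRelation.exists_isProduct`), and
uniqueness holds because `α` fixes the scale of a Haar measure. Associativity is inherited from the
product of kernels.
-/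

set_option linter.unusedSectionVars false

/-! ### Homomorphisms that push a Haar measure below a Haar measure -/

section DominatedImage

open Topology Set Pointwise

variable {P G : Type*}
  [Group P] [TopologicalSpace P] [IsTopologicalGroup P] [T2Space P] [LocallyCompactSpace P]
  [SecondCountableTopology P] [MeasurableSpace P] [BorelSpace P]
  [Group G] [TopologicalSpace G] [IsTopologicalGroup G] [T2Space G] [LocallyCompactSpace G]
  [SecondCountableTopology G] [MeasurableSpace G] [BorelSpace G]
  {ρ : Measure P} [ρ.IsHaarMeasure] {γ : Measure G} [γ.IsHaarMeasure]
  {f : P →* G}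

/-- A homomorphism whose image of the Haar measure is locally finite is proper: otherwise the
preimage of a compact set contains infinitely many points with disjoint translates of a fixed
compact neighbourhood of `1`, all inside the preimage of another compact set. -/
theorem isProperMap_of_map_haar_le (hf : Continuous f) (h : ρ.map f ≤ γ) : IsProperMap f := by
  rw [isProperMap_iff_isCompact_preimage]
  refine ⟨hf, fun C hC => ?_⟩
  obtain ⟨U, hU, hU1⟩ := exists_compact_mem_nhds (1 : P)
  have hfin : ρ (f ⁻¹' (C * f '' U)) ≠ ∞ := by
    have hc : IsCompact (C * f '' U) := hC.mul (hU.image hf)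
    have := h (C * f '' U)
    rw [Measure.map_apply hf.measurable hc.measurableSet] at this
    exact (this.trans_lt hc.measure_lt_top).ne
  by_contra hnc
  -- a point `y` with `y • U` meeting some `x • U` lies in the compact set `x • (U * U⁻¹)`
  have step : ∀ s : Finset P, (∀ x ∈ s, x ∈ f ⁻¹' C) →
      ∃ y, y ∈ f ⁻¹' C ∧ ∀ x ∈ s, Disjoint (x • U) (y • U) := by
    intro s _
    by_contra! hs
    refine hnc ?_
    have hcomp : IsCompact (⋃ x ∈ s, x • (U * U⁻¹)) :=
      s.isCompact_biUnion fun x _ => (hU.mul hU.inv).smul x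
    refine hcomp.of_isClosed_subset (hC.isClosed.preimage hf) fun y hy => ?_
    obtain ⟨x, hx, hxy⟩ := hs y hy
    rw [Set.not_disjoint_iff] at hxy
    obtain ⟨_, ⟨u, hu, rfl⟩, ⟨v, hv, huv⟩⟩ := hxy
    simp only [smul_eq_mul] at huv
    refine mem_iUnion₂.2 ⟨x, hx, u * v⁻¹, Set.mul_mem_mul hu (Set.inv_mem_inv.2 hv), ?_⟩
    simp only [smul_eq_mul]
    rw [← mul_assoc, ← huv, mul_inv_cancel_right]
  have : Std.Symm fun x y : P => Disjoint (x • U) (y • U) := ⟨fun _ _ hd => hd.symm⟩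
  obtain ⟨x, hx, hd⟩ := exists_seq_of_forall_finset_exists' _ _ step
  -- the translates `x n • U` are disjoint, of the same positive measure, in a set of finite measure
  have hpos : 0 < ρ U := Measure.measure_pos_of_mem_nhds ρ hU1
  have hfinite := Measure.finite_const_le_meas_of_disjoint_iUnion ρ hpos
    (As := fun n => x n • U) (fun n => (hU.smul (x n)).measurableSet) hd
    (ne_top_of_le_ne_top hfin <| measure_mono <| iUnion_subset fun n => by
      rintro _ ⟨u, hu, rfl⟩
      simp only [smul_eq_mul, mem_preimage, map_mul]
      exact Set.mul_mem_mul (hx n) (mem_image_of_mem f hu))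
  have huniv : {n : ℕ | ρ U ≤ ρ (x n • U)} = univ := by
    ext n
    simp [measure_smul]
  rw [huniv] at hfinite
  exact Set.infinite_univ hfinite

/-- The range has positive measure, so it is open by Steinhaus' theorem. -/
theorem isOpen_range_of_map_haar_le (hf : Continuous f) (h : ρ.map f ≤ γ) :
    IsOpen (f.range : Set G) := by
  have hcl : IsClosed (f.range : Set G) := by
    rw [MonoidHom.coe_range]
    exact (isProperMap_of_map_haar_le hf h).isClosedMap.isClosed_range
  have hpos : 0 < γ (f.range : Set G) := by
    refine lt_of_lt_of_le ?_ (h _)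
    rw [Measure.map_apply hf.measurable hcl.measurableSet, MonoidHom.coe_range,
      preimage_range]
    exact Measure.measure_univ_pos.2 (NeZero.ne ρ)
  refine Subgroup.isOpen_of_mem_nhds f.range (g := 1)
    (Filter.mem_of_superset
      (Measure.div_mem_nhds_one_of_haar_pos γ _ hcl.measurableSet hpos) ?_)
  rintro _ ⟨a, ha, b, hb, rfl⟩
  exact f.range.div_mem ha hb

theorem smul_restrict_le_iff {X : Type*} [MeasurableSpace X] {μ : Measure X} [SigmaFinite μ]
    {D : Set X} (hD : MeasurableSet D) (hpos : μ D ≠ 0) {a b : ℝ≥0} :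
    a • μ.restrict D ≤ b • μ.restrict D ↔ a ≤ b := by
  refine ⟨fun h => ?_, fun h => ?_⟩
  · obtain ⟨s, hsD, hs0, hst⟩ : ∃ s ⊆ D, 0 < μ s ∧ μ s < ∞ := by
      obtain ⟨s, _, hs, h1, h2⟩ := Measure.exists_subset_measure_lt_top hD hpos.bot_lt
      exact ⟨s, hs, h1, h2⟩
    have := h s
    simp only [Measure.smul_apply, Measure.restrict_eq_self μ hsD] at this
    rw [ENNReal.smul_def, ENNReal.smul_def, smul_eq_mul, smul_eq_mul,
      ENNReal.mul_le_mul_iff_left hs0.ne' hst.ne] at this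
    exact_mod_cast this
  · refine Measure.le_iff.2 fun s _ => ?_
    simp only [Measure.smul_apply]
    gcongr

theorem smul_restrict_inj {X : Type*} [MeasurableSpace X] {μ : Measure X} [SigmaFinite μ]
    {D : Set X} (hD : MeasurableSet D) (hpos : μ D ≠ 0) {a b : ℝ≥0}
    (h : a • μ.restrict D = b • μ.restrict D) : a = b :=
  le_antisymm ((smul_restrict_le_iff hD hpos).1 h.le) ((smul_restrict_le_iff hD hpos).1 h.ge)

/-- By uniqueness of Haar measure on the open subgroup `f.range`, the image of `ρ` is a multiple
of the restriction of `γ`. -/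
theorem exists_map_haar_eq_smul_restrict (hf : Continuous f) (h : ρ.map f ≤ γ) :
    ∃ a : ℝ≥0, ρ.map f = a • γ.restrict (f.range : Set G) ∧ 0 < a ∧ a ≤ 1 := by
  have hopen := isOpen_range_of_map_haar_le hf h
  have hprop := isProperMap_of_map_haar_le hf h
  have hemb : IsOpenEmbedding (f.range.subtype : f.range → G) := hopen.isOpenEmbedding_subtypeVal
  have hcl : IsClosed (f.range : Set G) := f.range.isClosed_of_isOpen hopen
  have : LocallyCompactSpace f.range := hcl.isClosedEmbedding_subtypeVal.locallyCompactSpace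
  have : SecondCountableTopology f.range :=
    TopologicalSpace.Subtype.secondCountableTopology (f.range : Set G)
  have hcont : Continuous f.rangeRestrict := hf.subtype_mk _
  have : (γ.comap f.range.subtype).IsHaarMeasure :=
    Measure.IsHaarMeasure.comap (mH := inferInstance) γ hemb
  have hrprop : IsProperMap f.rangeRestrict := by
    refine isProperMap_of_comp_of_inj hcont continuous_subtype_val ?_ Subtype.val_injective
    exact hprop
  have : (ρ.map f.rangeRestrict).IsHaarMeasure := by
    refine Measure.isHaarMeasure_map ρ f.rangeRestrict hcont f.rangeRestrict_surjective ?_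
    exact (isProperMap_iff_tendsto_cocompact.1 hrprop).2
  obtain ⟨a, ha⟩ : ∃ a : ℝ≥0, ρ.map f.rangeRestrict = a • γ.comap f.range.subtype :=
    ⟨_, Measure.isMulLeftInvariant_eq_smul _ _⟩
  have hmap : ρ.map f = a • γ.restrict (f.range : Set G) := by
    have h1 : ρ.map f = (ρ.map f.rangeRestrict).map f.range.subtype := by
      rw [Measure.map_map hemb.continuous.measurable hcont.measurable]
      rfl
    rw [h1, ha, Measure.map_smul, hemb.measurableEmbedding.map_comap]
    congr 2
    exact Subtype.range_coe
  have hpos : γ (f.range : Set G) ≠ 0 := (hopen.measure_pos γ ⟨1, f.range.one_mem⟩).ne'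
  refine ⟨a, hmap, pos_iff_ne_zero.2 ?_, ?_⟩
  · rintro rfl
    rw [zero_smul, Measure.map_eq_zero_iff hf.aemeasurable] at hmap
    exact NeZero.ne ρ hmap
  · refine (smul_restrict_le_iff (μ := γ) hopen.measurableSet hpos).1 ?_
    rw [← hmap, one_smul]
    refine Measure.le_iff.2 fun s hs => ?_
    have : ρ.map f s = ρ.map f (s ∩ f.range) := by
      rw [Measure.map_apply hf.measurable hs,
        Measure.map_apply hf.measurable (hs.inter hopen.measurableSet)]
      congr 1
      ext x
      simp
    rw [this, Measure.restrict_apply hs]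
    exact h _

/-- `ρ` is right invariant under `ker f`: a right translate of `ρ` by an element of the kernel is
a multiple of `ρ` with the same image in `G`. -/
theorem map_mul_right_eq_of_mem_ker (hf : Continuous f) (h : ρ.map f ≤ γ) {z : P}
    (hz : z ∈ f.ker) : ρ.map (· * z) = ρ := by
  obtain ⟨c, hc⟩ : ∃ c : ℝ≥0, ρ.map (· * z) = c • ρ := ⟨_, Measure.isMulLeftInvariant_eq_smul _ _⟩
  obtain ⟨a, ha, ha0, -⟩ := exists_map_haar_eq_smul_restrict hf h
  have hopen := isOpen_range_of_map_haar_le hf h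
  have h1 : (ρ.map (· * z)).map f = ρ.map f := by
    rw [Measure.map_map hf.measurable (measurable_mul_const z)]
    congr 1
    ext x
    simp [(MonoidHom.mem_ker).1 hz]
  rw [hc, Measure.map_smul, ha, smul_smul] at h1
  have h2 := smul_restrict_inj (μ := γ) hopen.measurableSet
    (hopen.measure_pos γ ⟨1, f.range.one_mem⟩).ne' h1
  rw [hc, (mul_eq_right₀ ha0.ne').1 h2, one_smul]

end DominatedImage

/-! ### Conditional measures -/

/-- The Haar probability measure of a compact subgroup `N`, as a measure on the whole group. An
open subgroup `U` cuts out of `N` a piece of mass `1 / [N : N ∩ U]`. -/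
theorem exists_haarProbability {H : Type*} [Group H] [TopologicalSpace H]
    [IsTopologicalGroup H] [T2Space H] [MeasurableSpace H] [BorelSpace H]
    {N : Subgroup H} (hN : IsCompact (N : Set H)) :
    ∃ m : Measure H, IsProbabilityMeasure m ∧ (∀ n ∈ N, m.map (n * ·) = m) ∧
      (∀ᵐ x ∂m, x ∈ N) ∧
      ∀ U : Subgroup H, IsOpen (U : Set H) →
        U.relIndex N ≠ 0 ∧ m U = (U.relIndex N : ℝ≥0∞)⁻¹ := by
  have : CompactSpace N := isCompact_iff_compactSpace.1 hN
  have hmeas : MeasurableSet (N : Set H) := hN.measurableSet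
  let m₀ : Measure N := Measure.haarMeasure ⊤
  have : IsProbabilityMeasure m₀ := ⟨Measure.haarMeasure_self (K₀ := ⊤)⟩
  refine ⟨m₀.map (↑), Measure.isProbabilityMeasure_map measurable_subtype_coe.aemeasurable,
    fun n hn => ?_, ?_, fun U hU => ?_⟩
  · rw [Measure.map_map (measurable_const_mul n) measurable_subtype_coe]
    have : ((n * ·) ∘ ((↑) : N → H)) = (↑) ∘ ((⟨n, hn⟩ : N) * ·) := by
      ext x
      rfl
    rw [this, ← Measure.map_map measurable_subtype_coe (measurable_const_mul _),
      map_mul_left_eq_self]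
  · refine (ae_map_iff measurable_subtype_coe.aemeasurable hmeas).2 ?_
    exact Filter.Eventually.of_forall fun x => x.2
  · have hV : IsOpen (U.subgroupOf N : Set N) := hU.preimage continuous_subtype_val
    have hfin : Finite (N ⧸ U.subgroupOf N) := Subgroup.quotient_finite_of_isOpen _ hV
    have hFI : (U.subgroupOf N).FiniteIndex := Subgroup.finiteIndex_of_finite_quotient
    refine ⟨hFI.index_ne_zero, ?_⟩
    have := (U.subgroupOf N).index_mul_measure hV.measurableSet m₀
    rw [measure_univ] at this
    rw [Measure.map_apply measurable_subtype_coe hU.measurableSet]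
    exact ENNReal.eq_inv_of_mul_eq_one_left ((mul_comm _ _).trans this)

/-- Conditional measures for the image in `G × H` of a Haar measure `ρ` under a pair of
homomorphisms `f : P →* G`, `p : P →* H`, where `a` is the factor of `ρ.map f` with respect to `γ`.
The measure `k g` is `a` times the invariant probability measure of the coset `p (f ⁻¹' {g})` of
`p (ker f)`, and `0` if `g` is not in the range of `f`; the fields list what this entails. -/
structure IsCosetKernel {P G H : Type*} [Group P] [MeasurableSpace P] [Group G] [MeasurableSpace G]
    [Group H] [TopologicalSpace H] [MeasurableSpace H] (ρ : Measure P) (γ : Measure G)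
    (f : P →* G) (p : P →* H) (a : ℝ≥0) (k : Kernel G H) : Prop where
  univ_le : ∀ g, k g Set.univ ≤ 1
  measure_eq : ∀ (A : Set G) (B : Set H), MeasurableSet A → MeasurableSet B →
    ρ (f ⁻¹' A ∩ p ⁻¹' B) = ∫⁻ g in A, k g B ∂γ
  map_mul : ∀ (x : P) (g : G), k (f x * g) = (k g).map (p x * ·)
  ae_mem : ∀ g, ∀ᵐ h ∂(k g), ∃ x, f x = g ∧ p x = h
  apply_subgroup : ∀ U : Subgroup H, IsOpen (U : Set H) → ∀ g,
    k g U = {g | ∃ x, f x = g ∧ p x ∈ U}.indicator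
      (fun _ => (a : ℝ≥0∞) / (U.relIndex (f.ker.map p) : ℝ≥0∞)) g

section CosetKernel

open Topology Set

variable {P G H : Type*}
  [Group P] [TopologicalSpace P] [IsTopologicalGroup P] [T2Space P] [LocallyCompactSpace P]
  [SecondCountableTopology P] [MeasurableSpace P] [BorelSpace P]
  [Group G] [TopologicalSpace G] [IsTopologicalGroup G] [T2Space G] [LocallyCompactSpace G]
  [SecondCountableTopology G] [MeasurableSpace G] [BorelSpace G]
  [Group H] [TopologicalSpace H] [IsTopologicalGroup H] [T2Space H] [LocallyCompactSpace H]
  [SecondCountableTopology H] [MeasurableSpace H] [BorelSpace H]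
  {ρ : Measure P} [ρ.IsHaarMeasure] {γ : Measure G} [γ.IsHaarMeasure]
  {f : P →* G} {p : P →* H}

theorem isCompact_map_ker (hf : Continuous f) (hp : Continuous p) (h : ρ.map f ≤ γ) :
    IsCompact (f.ker.map p : Set H) := by
  have : IsCompact (f.ker : Set P) :=
    (isProperMap_of_map_haar_le hf h).isCompact_preimage isCompact_singleton
  exact this.image hp

/-- Right invariance of `ρ` under `ker f` allows replacing the indicator of `B` on `P` by its
average over `ker f`, which depends only on the value of `f`. -/
theorem exists_isCosetKernel (hf : Continuous f) (hp : Continuous p) (h : ρ.map f ≤ γ) {a : ℝ≥0}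
    (ha : ρ.map f = a • γ.restrict (f.range : Set G)) (ha0 : 0 < a) (ha1 : a ≤ 1) :
    ∃ k : Kernel G H, IsCosetKernel ρ γ f p a k := by
  classical
  obtain ⟨m, hm, hinv, hsupp, hidx⟩ := exists_haarProbability (isCompact_map_ker hf hp h)
  have hopen := isOpen_range_of_map_haar_le hf h
  have hmulmeas : Measurable fun x : P × H => p x.1 * x.2 :=
    ((hp.comp continuous_fst).mul continuous_snd).measurable
  let φ : G → Measure H := fun g =>
    if hg : ∃ x, f x = g then a • m.map (p hg.choose * ·) else 0
  have hφ : ∀ x, φ (f x) = a • m.map (p x * ·) := by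
    intro x
    have hx : ∃ y, f y = f x := ⟨x, rfl⟩
    -- two points of a fibre of `f` differ by an element of the kernel, which preserves `m`
    have hker : x⁻¹ * hx.choose ∈ f.ker := by
      rw [MonoidHom.mem_ker, map_mul, hx.choose_spec, map_inv, inv_mul_cancel]
    have h1 := hinv _ (Subgroup.mem_map_of_mem p hker)
    simp only [φ, dif_pos hx]
    conv_rhs => rw [← h1]
    rw [Measure.map_map (measurable_const_mul _) (measurable_const_mul _)]
    congr 2
    ext y
    simp [mul_assoc]
  have hφ0 : ∀ g, (¬ ∃ x, f x = g) → φ g = 0 := fun g hg => dif_neg hg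
  have hφf : Measurable fun x => φ (f x) := by
    refine Measure.measurable_of_measurable_coe _ fun B hB => ?_
    have : (fun x => φ (f x) B) = fun x => (a : ℝ≥0∞) * m (Prod.mk x ⁻¹'
        ((fun x : P × H => p x.1 * x.2) ⁻¹' B)) := by
      ext x
      rw [hφ, Measure.smul_apply, Measure.map_apply (measurable_const_mul _) hB]
      rfl
    rw [this]
    exact (measurable_measure_prodMk_left (hmulmeas hB)).const_mul _
  -- `φ` is measurable because `φ ∘ f` is, and `f` is a surjection of standard Borel spaces
  have hφm : Measurable φ := by
    refine measurable_of_restrict_of_restrict_compl hopen.measurableSet ?_ ?_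
    · have hr : Measurable f.rangeRestrict := (hf.subtype_mk _).measurable
      exact (hr.measurable_comp_iff_of_surjective f.rangeRestrict_surjective
        (g := (f.range : Set G).domRestrict φ)).1 hφf
    · have : (f.range : Set G)ᶜ.domRestrict φ = fun _ => 0 := by
        ext1 g
        exact hφ0 g g.2
      rw [this]
      exact measurable_const
  have hcase : ∀ (g : G), (∃ x, f x = g) ∨ φ g = 0 := fun g => or_iff_not_imp_left.2 (hφ0 g)
  refine ⟨⟨φ, hφm⟩, ⟨fun g => ?_, fun A B hA hB => ?_, fun x g => ?_, fun g => ?_,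
    fun U hU g => ?_⟩⟩
  · change φ g univ ≤ 1
    rcases hcase g with ⟨x, rfl⟩ | h0
    · rw [hφ, Measure.smul_apply, Measure.map_apply (measurable_const_mul _) MeasurableSet.univ,
        preimage_univ, measure_univ, ENNReal.smul_def, smul_eq_mul, mul_one]
      exact_mod_cast ha1
    · simp [h0]
  · change _ = ∫⁻ g in A, φ g B ∂γ
    have hφB : Measurable fun g => φ g B := (Measure.measurable_coe hB).comp hφm
    have hA' : MeasurableSet (f ⁻¹' A) := hf.measurable hA
    have hE : MeasurableSet ((fun x : P × H => p x.1 * x.2) ⁻¹' B) := hmulmeas hB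
    -- the integral over `f ⁻¹' A` of the mass of `B` in the coset measures, computed over `G`
    have h1 : ∫⁻ x in f ⁻¹' A, φ (f x) B ∂ρ = a * ∫⁻ g in A, φ g B ∂γ := by
      rw [← setLIntegral_map hA hφB hf.measurable, ha, Measure.restrict_smul,
        lintegral_smul_measure, ENNReal.smul_def, smul_eq_mul,
        Measure.restrict_restrict hA, inter_comm, ← Measure.restrict_restrict hopen.measurableSet,
        ← lintegral_indicator hopen.measurableSet]
      congr 1
      refine lintegral_congr fun g => ?_
      by_cases hg : g ∈ (f.range : Set G)
      · rw [indicator_of_mem hg]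
      · rw [indicator_of_notMem hg, hφ0 g hg]
        rfl
    -- and over `P`, where averaging over `ker f` does not change `ρ`
    have h2 : ∫⁻ x in f ⁻¹' A, φ (f x) B ∂ρ = a * ρ (f ⁻¹' A ∩ p ⁻¹' B) := by
      have e1 : ∀ x, φ (f x) B = a * m (Prod.mk x ⁻¹' ((fun x : P × H => p x.1 * x.2) ⁻¹' B)) := by
        intro x
        rw [hφ, Measure.smul_apply, Measure.map_apply (measurable_const_mul _) hB]
        rfl
      simp_rw [e1]
      rw [lintegral_const_mul _ (measurable_measure_prodMk_left hE), ← Measure.prod_apply hE,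
        Measure.prod_apply_symm hE]
      congr 1
      have e2 : ∀ᵐ n ∂m, (ρ.restrict (f ⁻¹' A)) ((fun x => (x, n)) ⁻¹'
          ((fun x : P × H => p x.1 * x.2) ⁻¹' B)) = ρ (f ⁻¹' A ∩ p ⁻¹' B) := by
        filter_upwards [hsupp] with n hn
        obtain ⟨z, hz, rfl⟩ := hn
        rw [Measure.restrict_apply (measurable_prodMk_right hE)]
        conv_rhs => rw [← map_mul_right_eq_of_mem_ker hf h hz]
        rw [Measure.map_apply (measurable_mul_const z) (hA'.inter (hp.measurable hB))]
        congr 1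
        ext x
        simp [(MonoidHom.mem_ker).1 hz, and_comm]
      rw [lintegral_congr_ae e2, lintegral_const, measure_univ, mul_one]
    rw [h1] at h2
    exact ((ENNReal.mul_right_inj (by simpa using ha0.ne') ENNReal.coe_ne_top).1 h2).symm
  · change φ (f x * g) = (φ g).map _
    by_cases hg : ∃ y, f y = g
    · obtain ⟨y, rfl⟩ := hg
      rw [← map_mul, hφ, hφ, Measure.map_smul,
        Measure.map_map (measurable_const_mul _) (measurable_const_mul _)]
      congr 2
      ext n
      simp [mul_assoc]
    · rw [hφ0 g hg, hφ0, Measure.map_zero]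
      rintro ⟨y, hy⟩
      exact hg ⟨x⁻¹ * y, by rw [map_mul, hy, map_inv, inv_mul_cancel_left]⟩
  · change ∀ᵐ h ∂(φ g), _
    rcases hcase g with ⟨x, rfl⟩ | h0
    · rw [hφ]
      refine Measure.ae_smul_measure ?_ a
      rw [(measurableEmbedding_mulLeft (p x)).ae_map_iff]
      filter_upwards [hsupp] with n hn
      obtain ⟨z, hz, rfl⟩ := hn
      exact ⟨x * z, by rw [map_mul, (MonoidHom.mem_ker).1 hz, mul_one], map_mul p x z⟩
    · simp [h0]
  · change φ g U = _
    by_cases hg : g ∈ {g | ∃ x, f x = g ∧ p x ∈ U}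
    · rw [indicator_of_mem hg]
      obtain ⟨x, rfl, hx⟩ := hg
      rw [hφ, Measure.smul_apply, Measure.map_apply (measurable_const_mul _) hU.measurableSet]
      have : (p x * ·) ⁻¹' (U : Set H) = U := by
        ext n
        exact U.mul_mem_cancel_left hx
      rw [this, (hidx U hU).2]
      rfl
    · rw [indicator_of_notMem hg]
      rcases hcase g with ⟨x, rfl⟩ | h0
      · rw [hφ, Measure.smul_apply, Measure.map_apply (measurable_const_mul _) hU.measurableSet]
        have : m ((p x * ·) ⁻¹' (U : Set H)) = 0 := by
          refine measure_mono_null ?_ (ae_iff.1 hsupp)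
          rintro n hn ⟨z, hz, rfl⟩
          exact hg ⟨x * z, by rw [map_mul, (MonoidHom.mem_ker).1 hz, mul_one],
            by rw [map_mul]; exact hn⟩
        rw [this, smul_zero]
      · simp [h0]

end CosetKernel

/-! ### Products of conditional measures -/

/-- The product of two kernels in terms of the middle space: `r'` are the conditional measures
in the direction opposite to `r`. The right-hand side is symmetric in the outer spaces. -/
theorem setLIntegral_comp_eq_lintegral_mul {X Y Z : Type*} [MeasurableSpace X] [MeasurableSpace Y]
    [MeasurableSpace Z] {ξ : Measure X} {υ : Measure Y} {r : Kernel X Y} {r' : Kernel Y X}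
    (hr : ∀ (A : Set X) (B : Set Y), MeasurableSet A → MeasurableSet B →
      ∫⁻ x in A, r x B ∂ξ = ∫⁻ y in B, r' y A ∂υ)
    (t : Kernel Y Z) {A : Set X} {C : Set Z} (hA : MeasurableSet A) (hC : MeasurableSet C) :
    ∫⁻ x in A, (t ∘ₖ r) x C ∂ξ = ∫⁻ y, r' y A * t y C ∂υ := by
  have hb : (ξ.restrict A).bind r = υ.withDensity fun y => r' y A := by
    ext B hB
    rw [Measure.bind_apply hB r.aemeasurable, withDensity_apply _ hB, hr A B hA hB]
  calc ∫⁻ x in A, (t ∘ₖ r) x C ∂ξ = ∫⁻ x in A, ∫⁻ y, t y C ∂(r x) ∂ξ :=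
        lintegral_congr fun x => Kernel.comp_apply' _ _ _ hC
    _ = ∫⁻ y, t y C ∂((ξ.restrict A).bind r) :=
        (Measure.lintegral_bind r.aemeasurable (Kernel.measurable_coe t hC).aemeasurable).symm
    _ = ∫⁻ y, r' y A * t y C ∂υ := by
        rw [hb, lintegral_withDensity_eq_lintegral_mul _ (Kernel.measurable_coe r' hA)
          (Kernel.measurable_coe t hC)]
        rfl

section CosetKernelComp

open Set

variable {P Q G H K : Type*} [Group P] [MeasurableSpace P] [Group Q] [MeasurableSpace Q]
  [Group G] [MeasurableSpace G] [Group H] [TopologicalSpace H] [MeasurableSpace H]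
  [Group K] [TopologicalSpace K] [MeasurableSpace K]
  {ρ : Measure P} {τ : Measure Q} {γ : Measure G} {η : Measure H}
  {f : P →* G} {p : P →* H} {f' : Q →* H} {q : Q →* K} {a b : ℝ≥0}
  {r : Kernel G H} {t : Kernel H K}

theorem IsCosetKernel.comp_map_mul [MeasurableMul H] [MeasurableMul K]
    (hr : IsCosetKernel ρ γ f p a r)
    (ht : IsCosetKernel τ η f' q b t) {x : P} {y : Q} (hxy : p x = f' y) (g : G) :
    (t ∘ₖ r) (f x * g) = ((t ∘ₖ r) g).map (q y * ·) := by
  ext C hC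
  rw [Measure.map_apply (measurable_const_mul _) hC, Kernel.comp_apply' _ _ _ hC,
    Kernel.comp_apply' _ _ _ (measurable_const_mul _ hC), hr.map_mul,
    lintegral_map (Kernel.measurable_coe t hC) (measurable_const_mul _)]
  refine lintegral_congr fun h => ?_
  rw [hxy, ht.map_mul, Measure.map_apply (measurable_const_mul _) hC]

theorem IsCosetKernel.comp_apply_univ [OpensMeasurableSpace H] (hr : IsCosetKernel ρ γ f p a r)
    (ht : IsCosetKernel τ η f' q b t) (hopen : IsOpen (f'.range : Set H)) (g : G) :
    (t ∘ₖ r) g univ = {g | ∃ x, f x = g ∧ p x ∈ f'.range}.indicator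
      (fun _ => (a * b : ℝ≥0∞) / (f'.range.relIndex (f.ker.map p) : ℝ≥0∞)) g := by
  -- the case `U = ⊤`, where the index is `1`, gives the total mass of the conditional measures
  have h1 : ∀ h, t h univ = (f'.range : Set H).indicator (fun _ => (b : ℝ≥0∞)) h := by
    intro h
    have := ht.apply_subgroup ⊤ isOpen_univ h
    simp only [Subgroup.coe_top, Subgroup.mem_top, and_true, Subgroup.relIndex_top_left,
      Nat.cast_one, div_one] at this
    rw [this]
    rfl
  rw [Kernel.comp_apply' _ _ _ MeasurableSet.univ]
  simp_rw [h1]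
  rw [lintegral_indicator_const hopen.measurableSet, hr.apply_subgroup _ hopen]
  by_cases hg : g ∈ {g | ∃ x, f x = g ∧ p x ∈ f'.range}
  · rw [indicator_of_mem hg, indicator_of_mem hg, mul_comm (a : ℝ≥0∞), mul_div_assoc]
  · rw [indicator_of_notMem hg, indicator_of_notMem hg, mul_zero]

variable [SFinite γ] [IsSFiniteKernel (t ∘ₖ r)]

/-- The product measure is invariant under the product of the relations `(f, p)` and `(f', q)`. -/
theorem IsCosetKernel.map_mul_compProd_comp [MeasurableMul G] [MeasurableMul H]
    [MeasurableMul K] [MeasurableMul (G × K)] [γ.IsMulLeftInvariant]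
    (hr : IsCosetKernel ρ γ f p a r) (ht : IsCosetKernel τ η f' q b t) {x : P} {y : Q}
    (hxy : p x = f' y) :
    (γ ⊗ₘ (t ∘ₖ r)).map ((f x, q y) * ·) = γ ⊗ₘ (t ∘ₖ r) := by
  ext s hs
  have hs' : MeasurableSet (((f x, q y) * ·) ⁻¹' s) := measurable_const_mul (f x, q y) hs
  rw [Measure.map_apply (measurable_const_mul _) hs, Measure.compProd_apply hs',
    Measure.compProd_apply hs,
    ← lintegral_mul_left_eq_self (fun g => (t ∘ₖ r) g (Prod.mk g ⁻¹' s)) (f x)]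
  refine lintegral_congr fun g => ?_
  rw [hr.comp_map_mul ht hxy,
    Measure.map_apply (measurable_const_mul _) (measurable_prodMk_left hs)]
  rfl

/-- The product measure is carried by the product of the relations `(f, p)` and `(f', q)`. -/
theorem IsCosetKernel.ae_mem_compProd_comp (hr : IsCosetKernel ρ γ f p a r)
    (ht : IsCosetKernel τ η f' q b t) {s : Set (G × K)} (hs : MeasurableSet s)
    (hmem : ∀ x y, p x = f' y → (f x, q y) ∈ s) :
    (γ ⊗ₘ (t ∘ₖ r)) sᶜ = 0 := by
  rw [Measure.compProd_apply hs.compl]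
  refine lintegral_eq_zero_of_ae_eq_zero (Filter.Eventually.of_forall fun g => ?_)
  change (t ∘ₖ r) g _ = 0
  rw [Kernel.comp_apply' _ _ _ (measurable_prodMk_left hs.compl)]
  refine lintegral_eq_zero_of_ae_eq_zero ?_
  filter_upwards [hr.ae_mem g] with h hh
  obtain ⟨x, rfl, rfl⟩ := hh
  refine measure_mono_null ?_ (ae_iff.1 (ht.ae_mem (p x)))
  rintro k hk ⟨y, hy, rfl⟩
  exact hk (hmem x y hy.symm)

theorem IsCosetKernel.map_fst_compProd_comp [OpensMeasurableSpace H]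
    (hr : IsCosetKernel ρ γ f p a r)
    (ht : IsCosetKernel τ η f' q b t) (hopen : IsOpen (f'.range : Set H))
    (hmeas : MeasurableSet {g | ∃ x, f x = g ∧ p x ∈ f'.range})
    (hidx : f'.range.relIndex (f.ker.map p) ≠ 0) :
    (γ ⊗ₘ (t ∘ₖ r)).map Prod.fst = (a * b / (f'.range.relIndex (f.ker.map p) : ℝ≥0)) •
      γ.restrict {g | ∃ x, f x = g ∧ p x ∈ f'.range} := by
  ext A hA
  rw [Measure.map_apply measurable_fst hA, ← prod_univ,
    Measure.compProd_apply_prod hA MeasurableSet.univ]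
  simp_rw [hr.comp_apply_univ ht hopen]
  rw [lintegral_indicator_const hmeas, Measure.restrict_apply hmeas, Measure.smul_apply,
    Measure.restrict_apply hA, inter_comm, ENNReal.smul_def, smul_eq_mul,
    ENNReal.coe_div (by simpa), ENNReal.coe_mul, ENNReal.coe_natCast]

end CosetKernelComp

/-! ### Nonzero polyhomomorphisms and their constants -/

namespace HaarRelation

section

variable {G H K : Type*} [Group G] [TopologicalSpace G] [MeasurableSpace G]
  [Group H] [TopologicalSpace H] [MeasurableSpace H]
  [Group K] [TopologicalSpace K] [MeasurableSpace K]
  {γ : Measure G} {η : Measure H} {κ : Measure K}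

/-- The projection of a relation `R ⊆ G × H` to `G`. -/
def fstHom (R : HaarRelation γ η) : R.rel →* G := (MonoidHom.fst G H).comp R.rel.subtype

/-- The projection of a relation `R ⊆ G × H` to `H`. -/
def sndHom (R : HaarRelation γ η) : R.rel →* H := (MonoidHom.snd G H).comp R.rel.subtype

variable (R : HaarRelation γ η)

theorem continuous_fstHom : Continuous R.fstHom := continuous_fst.comp continuous_subtype_val

theorem continuous_sndHom : Continuous R.sndHom := continuous_snd.comp continuous_subtype_val

theorem range_fstHom : R.fstHom.range = MultRel.dom R.rel := by
  rw [fstHom, MonoidHom.range_comp, Subgroup.range_subtype, MultRel.dom]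

theorem range_sndHom : R.sndHom.range = MultRel.im R.rel := by
  rw [sndHom, MonoidHom.range_comp, Subgroup.range_subtype, MultRel.im]

theorem map_sndHom_ker_fstHom : R.fstHom.ker.map R.sndHom = MultRel.indef R.rel := by
  ext h
  constructor
  · rintro ⟨⟨⟨g, h⟩, hr⟩, rfl : g = 1, rfl⟩
    exact hr
  · exact fun hr => ⟨⟨(1, h), hr⟩, rfl, rfl⟩

theorem map_fstHom_ker_sndHom : R.sndHom.ker.map R.fstHom = MultRel.ker R.rel := by
  ext g
  constructor
  · rintro ⟨⟨⟨g, h⟩, hr⟩, rfl : h = 1, rfl⟩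
    exact hr
  · exact fun hr => ⟨⟨(g, 1), hr⟩, rfl, rfl⟩

theorem map_fstHom_le : R.haar.map R.fstHom ≤ γ := R.fst_le

theorem map_sndHom_le : R.haar.map R.sndHom ≤ η := R.snd_le

theorem measure_ofRel_prod {A : Set G} {B : Set H} (hA : MeasurableSet A) (hB : MeasurableSet B) :
    (Polyhom.ofRel R).measure (A ×ˢ B) = R.haar (R.fstHom ⁻¹' A ∩ R.sndHom ⁻¹' B) := by
  rw [Polyhom.measure, Measure.map_apply measurable_subtype_coe (hA.prod hB)]
  rfl

theorem _root_.IsCosetKernel.isConditional {R : HaarRelation γ η} {k : Kernel G H} {a : ℝ≥0}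
    (hk : IsCosetKernel R.haar γ R.fstHom R.sndHom a k) :
    (Polyhom.ofRel R).toPolymorphism.IsConditional k := by
  refine ⟨hk.univ_le, fun A B hA hB => ?_⟩
  rw [← hk.measure_eq A B hA hB, ← R.measure_ofRel_prod hA hB]
  rfl

theorem setOf_fstHom_eq_dom_comp (T : HaarRelation η κ) :
    {g | ∃ x, R.fstHom x = g ∧ R.sndHom x ∈ T.fstHom.range} =
      (MultRel.dom (MultRel.comp T.rel R.rel) : Set G) := by
  ext g
  constructor
  · rintro ⟨⟨⟨g, h⟩, hr⟩, rfl, ⟨⟨h', k⟩, ht⟩, rfl : h' = h⟩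
    exact ⟨(g, k), ⟨h', hr, ht⟩, rfl⟩
  · rintro ⟨⟨g, k⟩, ⟨h, hr, ht⟩, rfl⟩
    exact ⟨⟨(g, h), hr⟩, rfl, ⟨(h, k), ht⟩, rfl⟩

theorem setOf_sndHom_eq_im_comp (T : HaarRelation η κ) :
    {k | ∃ y, T.sndHom y = k ∧ T.fstHom y ∈ R.sndHom.range} =
      (MultRel.im (MultRel.comp T.rel R.rel) : Set K) := by
  ext k
  constructor
  · rintro ⟨⟨⟨h, k⟩, ht⟩, rfl, ⟨⟨g, h'⟩, hr⟩, rfl : h' = h⟩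
    exact ⟨(g, k), ⟨h', hr, ht⟩, rfl⟩
  · rintro ⟨⟨g, k⟩, ⟨h, hr, ht⟩, rfl⟩
    exact ⟨⟨(h, k), ht⟩, rfl, ⟨(g, h), hr⟩, rfl⟩

end

section

variable {G H : Type*}
  [Group G] [TopologicalSpace G] [IsTopologicalGroup G] [T2Space G] [LocallyCompactSpace G]
  [SecondCountableTopology G] [MeasurableSpace G] [BorelSpace G]
  [Group H] [TopologicalSpace H] [IsTopologicalGroup H] [T2Space H] [LocallyCompactSpace H]
  [SecondCountableTopology H] [MeasurableSpace H] [BorelSpace H]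
  {γ : Measure G} [γ.IsHaarMeasure] {η : Measure H} [η.IsHaarMeasure]

instance (R : HaarRelation γ η) : R.haar.IsHaarMeasure := R.isHaar

instance (R : HaarRelation γ η) : LocallyCompactSpace R.rel :=
  R.isClosed.isClosedEmbedding_subtypeVal.locallyCompactSpace

instance (R : HaarRelation γ η) : SecondCountableTopology R.rel :=
  TopologicalSpace.Subtype.secondCountableTopology (R.rel : Set (G × H))

variable (R : HaarRelation γ η)

theorem isOpen_dom : IsOpen (MultRel.dom R.rel : Set G) :=
  R.range_fstHom ▸ isOpen_range_of_map_haar_le R.continuous_fstHom R.map_fstHom_le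

theorem isOpen_im : IsOpen (MultRel.im R.rel : Set H) :=
  R.range_sndHom ▸ isOpen_range_of_map_haar_le R.continuous_sndHom R.map_sndHom_le

theorem isAlpha_unique {a b : ℝ≥0} (ha : R.IsAlpha a) (hb : R.IsAlpha b) : a = b :=
  smul_restrict_inj R.isOpen_dom.measurableSet
    (R.isOpen_dom.measure_pos γ ⟨1, one_mem _⟩).ne' (ha.symm.trans hb)

theorem isBeta_unique {a b : ℝ≥0} (ha : R.IsBeta a) (hb : R.IsBeta b) : a = b :=
  smul_restrict_inj R.isOpen_im.measurableSet
    (R.isOpen_im.measure_pos η ⟨1, one_mem _⟩).ne' (ha.symm.trans hb)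

theorem exists_isAlpha : ∃ a, R.IsAlpha a ∧ 0 < a ∧ a ≤ 1 := by
  obtain ⟨a, ha, ha'⟩ := exists_map_haar_eq_smul_restrict R.continuous_fstHom R.map_fstHom_le
  exact ⟨a, by rwa [range_fstHom] at ha, ha'⟩

theorem exists_isBeta : ∃ b, R.IsBeta b ∧ 0 < b ∧ b ≤ 1 := by
  obtain ⟨b, hb, hb'⟩ := exists_map_haar_eq_smul_restrict R.continuous_sndHom R.map_sndHom_le
  exact ⟨b, by rwa [range_sndHom] at hb, hb'⟩

theorem isAlpha_alpha : R.IsAlpha R.alpha :=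
  Classical.epsilon_spec (R.exists_isAlpha.imp fun _ h => h.1)

theorem isBeta_beta : R.IsBeta R.beta :=
  Classical.epsilon_spec (R.exists_isBeta.imp fun _ h => h.1)

theorem alpha_mem : 0 < R.alpha ∧ R.alpha ≤ 1 := by
  obtain ⟨a, ha, ha'⟩ := R.exists_isAlpha
  rwa [R.isAlpha_unique R.isAlpha_alpha ha]

theorem beta_mem : 0 < R.beta ∧ R.beta ≤ 1 := by
  obtain ⟨b, hb, hb'⟩ := R.exists_isBeta
  rwa [R.isBeta_unique R.isBeta_beta hb]

/-- The Haar measure of a relation is determined by the constant `α`. -/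
theorem eq_of_rel_eq_of_alpha_eq {R S : HaarRelation γ η} (hrel : R.rel = S.rel)
    (hα : R.alpha = S.alpha) : R = S := by
  obtain ⟨N, hN, ν, hν, h1, h2⟩ := R
  obtain ⟨N', hN', ν', hν', h1', h2'⟩ := S
  obtain rfl : N = N' := hrel
  let R : HaarRelation γ η := ⟨N, hN, ν, hν, h1, h2⟩
  let S : HaarRelation γ η := ⟨N, hN', ν', hν', h1', h2'⟩
  have : LocallyCompactSpace N := hN.isClosedEmbedding_subtypeVal.locallyCompactSpace
  have : SecondCountableTopology N :=
    TopologicalSpace.Subtype.secondCountableTopology (N : Set (G × H))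
  obtain ⟨c, rfl⟩ : ∃ c : ℝ≥0, ν = c • ν' := ⟨_, Measure.isMulLeftInvariant_eq_smul ν ν'⟩
  have hc : R.IsAlpha (c * S.alpha) := by
    unfold IsAlpha
    rw [mul_smul, Measure.map_smul]
    exact congrArg (c • ·) S.isAlpha_alpha
  have hcα : c * S.alpha = S.alpha := (R.isAlpha_unique hc R.isAlpha_alpha).trans hα
  obtain rfl : c = 1 := (mul_eq_right₀ S.alpha_mem.1.ne').1 hcα
  simp only [one_smul]

theorem exists_isCosetKernel_fst :
    ∃ k, IsCosetKernel R.haar γ R.fstHom R.sndHom R.alpha k :=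
  exists_isCosetKernel R.continuous_fstHom R.continuous_sndHom R.map_fstHom_le
    (R.range_fstHom ▸ R.isAlpha_alpha) R.alpha_mem.1 R.alpha_mem.2

theorem exists_isCosetKernel_snd :
    ∃ k, IsCosetKernel R.haar η R.sndHom R.fstHom R.beta k :=
  exists_isCosetKernel R.continuous_sndHom R.continuous_fstHom R.map_sndHom_le
    (R.range_sndHom ▸ R.isBeta_beta) R.beta_mem.1 R.beta_mem.2

theorem relIndex_indef_ne_zero {U : Subgroup H} (hU : IsOpen (U : Set H)) :
    U.relIndex (MultRel.indef R.rel) ≠ 0 := by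
  rw [← map_sndHom_ker_fstHom]
  obtain ⟨m, -, -, -, h⟩ := exists_haarProbability
    (isCompact_map_ker R.continuous_fstHom R.continuous_sndHom R.map_fstHom_le)
  exact (h U hU).1

theorem relIndex_ker_ne_zero {U : Subgroup G} (hU : IsOpen (U : Set G)) :
    U.relIndex (MultRel.ker R.rel) ≠ 0 := by
  rw [← map_fstHom_ker_sndHom]
  obtain ⟨m, -, -, -, h⟩ := exists_haarProbability
    (isCompact_map_ker R.continuous_sndHom R.continuous_fstHom R.map_sndHom_le)
  exact (h U hU).1

/-- The product relation is the image of a closed set under the proper map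
`R × K → G × K`. -/
theorem isClosed_comp {K : Type*} [Group K] [TopologicalSpace K] [MeasurableSpace K]
    {κ : Measure K} (T : HaarRelation η κ) (R : HaarRelation γ η) :
    IsClosed (MultRel.comp T.rel R.rel : Set (G × K)) := by
  have hprop : IsProperMap (Prod.map R.fstHom (id : K → K)) :=
    (isProperMap_of_map_haar_le R.continuous_fstHom R.map_fstHom_le).prodMap
      (Homeomorph.refl K).isProperMap
  have hcl : IsClosed {x : R.rel × K | (R.sndHom x.1, x.2) ∈ T.rel} :=
    T.isClosed.preimage ((R.continuous_sndHom.comp continuous_fst).prodMk continuous_snd)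
  convert hprop.isClosedMap _ hcl
  ext ⟨g, k⟩
  constructor
  · rintro ⟨h, h1, h2⟩
    exact ⟨(⟨(g, h), h1⟩, k), h2, rfl⟩
  · rintro ⟨⟨⟨⟨g, h⟩, hr⟩, k⟩, h2, h3⟩
    obtain ⟨rfl, rfl⟩ := Prod.mk.inj h3
    exact ⟨h, hr, h2⟩

end

/-! ### The product of nonzero polyhomomorphisms -/

section

variable {G H K : Type*}
  [Group G] [TopologicalSpace G] [IsTopologicalGroup G] [T2Space G] [LocallyCompactSpace G]
  [SecondCountableTopology G] [MeasurableSpace G] [BorelSpace G]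
  [Group H] [TopologicalSpace H] [IsTopologicalGroup H] [T2Space H] [LocallyCompactSpace H]
  [SecondCountableTopology H] [MeasurableSpace H] [BorelSpace H]
  [Group K] [TopologicalSpace K] [IsTopologicalGroup K] [T2Space K] [LocallyCompactSpace K]
  [SecondCountableTopology K] [MeasurableSpace K] [BorelSpace K]
  {γ : Measure G} [γ.IsHaarMeasure] {η : Measure H} [η.IsHaarMeasure]
  {κ : Measure K} [κ.IsHaarMeasure]

theorem measurableSet_dom_comp (T : HaarRelation η κ) (R : HaarRelation γ η) :
    MeasurableSet (MultRel.dom (MultRel.comp T.rel R.rel) : Set G) := by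
  have hcl : IsClosed (T.fstHom.range : Set H) := by
    rw [range_fstHom]
    exact Subgroup.isClosed_of_isOpen _ T.isOpen_dom
  rw [← setOf_fstHom_eq_dom_comp]
  convert ((isProperMap_of_map_haar_le R.continuous_fstHom R.map_fstHom_le).isClosedMap _
    (hcl.preimage R.continuous_sndHom)).measurableSet using 1
  ext
  simp [and_comm]

theorem measurableSet_im_comp (T : HaarRelation η κ) (R : HaarRelation γ η) :
    MeasurableSet (MultRel.im (MultRel.comp T.rel R.rel) : Set K) := by
  have hcl : IsClosed (R.sndHom.range : Set H) := by
    rw [range_sndHom]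
    exact Subgroup.isClosed_of_isOpen _ R.isOpen_im
  rw [← setOf_sndHom_eq_im_comp]
  convert ((isProperMap_of_map_haar_le T.continuous_sndHom T.map_sndHom_le).isClosedMap _
    (hcl.preimage T.continuous_fstHom)).measurableSet using 1
  ext
  simp [and_comm]

/-- The product polymorphism of `T` and `R` has the image `α(R) α(T) / [indef R : indef R ∩ dom T]`
times `γ` in `G`, is invariant under and carried by `T R`; so it is the Haar measure sought. The
image in `K` is found in the same way, since the product of polymorphisms can be computed with
the conditional measures in the direction from `K` to `G`. -/
theorem exists_isProduct (T : HaarRelation η κ) (R : HaarRelation γ η) :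
    ∃ S : HaarRelation γ κ, IsProduct T R S ∧ (Polyhom.ofRel S).measure =
      ((Polyhom.ofRel T).toPolymorphism.comp (Polyhom.ofRel R).toPolymorphism).measure := by
  obtain ⟨r, hr⟩ := R.exists_isCosetKernel_fst
  obtain ⟨r', hr'⟩ := R.exists_isCosetKernel_snd
  obtain ⟨t, ht⟩ := T.exists_isCosetKernel_fst
  obtain ⟨t', ht'⟩ := T.exists_isCosetKernel_snd
  have : IsFiniteKernel r := ⟨1, ENNReal.one_lt_top, hr.univ_le⟩
  have : IsFiniteKernel r' := ⟨1, ENNReal.one_lt_top, hr'.univ_le⟩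
  have : IsFiniteKernel t := ⟨1, ENNReal.one_lt_top, ht.univ_le⟩
  have : IsFiniteKernel t' := ⟨1, ENNReal.one_lt_top, ht'.univ_le⟩
  set N : Subgroup (G × K) := MultRel.comp T.rel R.rel
  have hNcl : IsClosed (N : Set (G × K)) := isClosed_comp T R
  set ϰ := (Polyhom.ofRel T).toPolymorphism.comp (Polyhom.ofRel R).toPolymorphism
  have hπ : ϰ.measure = γ ⊗ₘ (t ∘ₖ r) :=
    Polymorphism.comp_measure_eq _ _ hr.isConditional ht.isConditional
  have hfst : ϰ.measure.map Prod.fst = (R.alpha * T.alpha /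
      ((MultRel.indef R.rel ⊓ MultRel.dom T.rel).relIndex (MultRel.indef R.rel) : ℝ≥0)) •
        γ.restrict (MultRel.dom N : Set G) := by
    rw [hπ, hr.map_fst_compProd_comp ht]
    · rw [setOf_fstHom_eq_dom_comp, range_fstHom, map_sndHom_ker_fstHom, Subgroup.inf_relIndex_left]
    · exact T.range_fstHom ▸ T.isOpen_dom
    · exact setOf_fstHom_eq_dom_comp R T ▸ measurableSet_dom_comp T R
    · rw [range_fstHom, map_sndHom_ker_fstHom]
      exact R.relIndex_indef_ne_zero T.isOpen_dom
  -- both sides are `∫ h, r' h univ * t h C ∂η`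
  have hswap : ϰ.measure.map Prod.snd = (κ ⊗ₘ (r' ∘ₖ t')).map Prod.fst := by
    ext C hC
    rw [Measure.map_apply measurable_snd hC, Measure.map_apply measurable_fst hC, hπ,
      ← Set.univ_prod, ← Set.prod_univ,
      Measure.compProd_apply_prod MeasurableSet.univ hC,
      Measure.compProd_apply_prod hC MeasurableSet.univ,
      setLIntegral_comp_eq_lintegral_mul (υ := η) (r' := r') _ t MeasurableSet.univ hC,
      setLIntegral_comp_eq_lintegral_mul (υ := η) (r' := t) _ r' hC MeasurableSet.univ]
    · exact lintegral_congr fun _ => mul_comm _ _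
    · intro A B hA hB
      rw [← ht.measure_eq B A hB hA, ← ht'.measure_eq A B hA hB, Set.inter_comm]
    · intro A B hA hB
      rw [← hr.measure_eq A B hA hB, ← hr'.measure_eq B A hB hA, Set.inter_comm]
  have hsnd : ϰ.measure.map Prod.snd = (R.beta * T.beta /
      ((MultRel.ker T.rel ⊓ MultRel.im R.rel).relIndex (MultRel.ker T.rel) : ℝ≥0)) •
        κ.restrict (MultRel.im N : Set K) := by
    rw [hswap, ht'.map_fst_compProd_comp hr']
    · rw [setOf_sndHom_eq_im_comp, range_sndHom, map_fstHom_ker_sndHom, Subgroup.inf_relIndex_left,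
        mul_comm T.beta]
    · exact R.range_sndHom ▸ R.isOpen_im
    · exact setOf_sndHom_eq_im_comp R T ▸ measurableSet_im_comp T R
    · rw [range_sndHom, map_fstHom_ker_sndHom]
      exact T.relIndex_ker_ne_zero R.isOpen_im
  have hcarried : ϰ.measure (N : Set (G × K))ᶜ = 0 := by
    rw [hπ]
    exact hr.ae_mem_compProd_comp ht hNcl.measurableSet fun x y hxy =>
      ⟨R.sndHom x, x.2, hxy ▸ y.2⟩
  have hinv : ∀ n ∈ N, ϰ.measure.map (n * ·) = ϰ.measure := by
    rintro ⟨g, k⟩ ⟨h, h1, h2⟩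
    rw [hπ]
    exact hr.map_mul_compProd_comp ht (x := ⟨(g, h), h1⟩) (y := ⟨(h, k), h2⟩) rfl
  have hemb : MeasurableEmbedding ((↑) : N → G × K) :=
    MeasurableEmbedding.subtype_coe hNcl.measurableSet
  set ν : Measure N := ϰ.measure.comap (↑) with hν
  have hνmap : ν.map (↑) = ϰ.measure := by
    rw [hν, hemb.map_comap, Subtype.range_coe]
    exact Measure.restrict_eq_self_of_ae_mem (ae_iff.2 hcarried)
  have hlc : LocallyCompactSpace N := hNcl.isClosedEmbedding_subtypeVal.locallyCompactSpace
  have hsc : SecondCountableTopology N :=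
    TopologicalSpace.Subtype.secondCountableTopology (N : Set (G × K))
  have hνfst : ν.map (fun n : N => (n : G × K).1) = ϰ.measure.map Prod.fst := by
    rw [← hνmap, Measure.map_map measurable_fst measurable_subtype_coe]
    rfl
  have hνsnd : ν.map (fun n : N => (n : G × K).2) = ϰ.measure.map Prod.snd := by
    rw [← hνmap, Measure.map_map measurable_snd measurable_subtype_coe]
    rfl
  have hνinv : ν.IsMulLeftInvariant := by
    refine ⟨fun n => ?_⟩
    ext s hs
    rw [Measure.map_apply (measurable_const_mul n) hs, hν, hemb.comap_apply, hemb.comap_apply]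
    conv_rhs => rw [← hinv n n.2]
    rw [Measure.map_apply (measurable_const_mul _) (hemb.measurableSet_image.2 hs)]
    congr 1
    ext x
    constructor
    · rintro ⟨y, hy, rfl⟩
      exact ⟨n * y, hy, rfl⟩
    · rintro ⟨y, hy, hyx⟩
      refine ⟨n⁻¹ * y, by simpa using hy, ?_⟩
      simp [hyx]
  -- the mass of a compact set is at most the `γ`-measure of its compact projection
  have hνfin : IsFiniteMeasureOnCompacts ν := by
    refine ⟨fun C hC => ?_⟩
    have hc : IsCompact ((fun n : N => (n : G × K).1) '' C) :=
      hC.image (continuous_fst.comp continuous_subtype_val)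
    refine lt_of_le_of_lt ?_ (hc.measure_lt_top (μ := γ))
    have := ϰ.fst_le ((fun n : N => (n : G × K).1) '' C)
    rw [← hνfst, Measure.map_apply (by fun_prop) hc.measurableSet] at this
    exact (measure_mono (Set.subset_preimage_image _ _)).trans this
  have hν0 : ν ≠ 0 := by
    intro h0
    rw [← hνfst, h0, Measure.map_zero] at hfst
    -- `dom (T R)` contains the projection of the nonempty open part of `R` over `dom T`
    have hpos : 0 < γ (MultRel.dom N : Set G) := by
      refine lt_of_lt_of_le ?_ (R.map_fstHom_le _)
      have ho : IsOpen (R.sndHom ⁻¹' (MultRel.dom T.rel : Set H)) :=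
        T.isOpen_dom.preimage R.continuous_sndHom
      rw [Measure.map_apply R.continuous_fstHom.measurable (measurableSet_dom_comp T R)]
      refine lt_of_lt_of_le (ho.measure_pos R.haar ⟨1, by simp⟩) (measure_mono ?_)
      rintro ⟨⟨g, h⟩, hr⟩ ⟨⟨h', k⟩, ht, rfl : h' = h⟩
      exact ⟨(g, k), ⟨h', hr, ht⟩, rfl⟩
    have hc : R.alpha * T.alpha / ((MultRel.indef R.rel ⊓ MultRel.dom T.rel).relIndex
        (MultRel.indef R.rel) : ℝ≥0) ≠ 0 := by
      refine div_ne_zero (mul_ne_zero R.alpha_mem.1.ne' T.alpha_mem.1.ne') ?_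
      rw [Subgroup.inf_relIndex_left]
      exact_mod_cast R.relIndex_indef_ne_zero T.isOpen_dom
    refine hc (smul_restrict_inj (measurableSet_dom_comp T R) hpos.ne' ?_)
    rw [zero_smul, ← hfst]
  have hνhaar : ν.IsHaarMeasure := by
    have : NeZero ν := ⟨hν0⟩
    exact { toIsOpenPosMeasure := inferInstance }
  refine ⟨⟨N, hNcl, ν, hνhaar, hνfst.trans_le ϰ.fst_le, hνsnd.trans_le ϰ.snd_le⟩,
    ⟨rfl, ?_, ?_⟩, hνmap⟩
  · exact isAlpha_unique _ (isAlpha_alpha _) (hνfst.trans hfst)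
  · exact isBeta_unique _ (isBeta_beta _) (hνsnd.trans hsnd)

end

end HaarRelation

/-! ### Associativity and comparison with polymorphisms -/

namespace Polymorphism

section

variable {X Y Z W : Type*} [MeasurableSpace X] [MeasurableSpace Y] [MeasurableSpace Z]
  [MeasurableSpace W] {ξ : Measure X} {υ : Measure Y} {ζ : Measure Z} {ω : Measure W}

theorem isConditional_comp [StandardBorelSpace Y] [StandardBorelSpace Z] [SigmaFinite ξ]
    [SigmaFinite υ] (ν : Polymorphism υ ζ) (μ : Polymorphism ξ υ) :
    (ν.comp μ).IsConditional (ν.cond ∘ₖ μ.cond) := by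
  have := μ.cond_spec.isFiniteKernel
  have := ν.cond_spec.isFiniteKernel
  exact ⟨fun x => comp_apply_univ_le μ.cond_spec ν.cond_spec x,
    fun A B hA hB => Measure.compProd_apply_prod hA hB⟩

theorem comp_assoc [StandardBorelSpace Y] [StandardBorelSpace Z] [StandardBorelSpace W]
    [SigmaFinite ξ] [SigmaFinite υ] [SigmaFinite ζ] (π : Polymorphism ζ ω) (ν : Polymorphism υ ζ)
    (μ : Polymorphism ξ υ) : (π.comp ν).comp μ = π.comp (ν.comp μ) := by
  ext1
  rw [comp_measure_eq _ _ μ.cond_spec (isConditional_comp π ν),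
    comp_measure_eq _ _ (isConditional_comp ν μ) π.cond_spec, Kernel.comp_assoc]

theorem isConditional_zero {μ : Polymorphism ξ υ} (h : μ.measure = 0) :
    μ.IsConditional (0 : Kernel X Y) := by
  refine ⟨fun x => by simp, fun A B _ _ => by simp [h]⟩

theorem comp_measure_of_left_eq_zero [StandardBorelSpace Y] [StandardBorelSpace Z] [SigmaFinite ξ]
    [SigmaFinite υ] {ν : Polymorphism υ ζ} (μ : Polymorphism ξ υ) (h : ν.measure = 0) :
    (ν.comp μ).measure = 0 := by
  rw [comp_measure_eq _ _ μ.cond_spec (isConditional_zero h), Kernel.zero_comp,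
    Measure.compProd_zero_right]

theorem comp_measure_of_right_eq_zero [StandardBorelSpace Y] [StandardBorelSpace Z] [SigmaFinite ξ]
    [SigmaFinite υ] (ν : Polymorphism υ ζ) {μ : Polymorphism ξ υ} (h : μ.measure = 0) :
    (ν.comp μ).measure = 0 := by
  rw [comp_measure_eq _ _ (isConditional_zero h) ν.cond_spec, Kernel.comp_zero,
    Measure.compProd_zero_right]

end

end Polymorphism

theorem MultRel.comp_assoc {G H K L : Type*} [Group G] [Group H] [Group K] [Group L]
    (S : Subgroup (K × L)) (T : Subgroup (H × K)) (R : Subgroup (G × H)) :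
    comp (comp S T) R = comp S (comp T R) := by
  ext ⟨g, l⟩
  constructor
  · rintro ⟨h, hR, k, hT, hS⟩
    exact ⟨k, ⟨h, hR, hT⟩, hS⟩
  · rintro ⟨k, ⟨h, hR, hT⟩, hS⟩
    exact ⟨h, hR, k, hT, hS⟩

section

variable {G H K : Type*}
  [Group G] [TopologicalSpace G] [IsTopologicalGroup G] [T2Space G] [LocallyCompactSpace G]
  [SecondCountableTopology G] [MeasurableSpace G] [BorelSpace G]
  [Group H] [TopologicalSpace H] [IsTopologicalGroup H] [T2Space H] [LocallyCompactSpace H]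
  [SecondCountableTopology H] [MeasurableSpace H] [BorelSpace H]
  [Group K] [TopologicalSpace K] [IsTopologicalGroup K] [T2Space K] [LocallyCompactSpace K]
  [SecondCountableTopology K] [MeasurableSpace K] [BorelSpace K]
  {γ : Measure G} [γ.IsHaarMeasure] {η : Measure H} [η.IsHaarMeasure]
  {κ : Measure K} [κ.IsHaarMeasure]

theorem HaarRelation.eq_of_rel_eq_of_measure_eq {R S : HaarRelation γ η} (hrel : R.rel = S.rel)
    (h : (Polyhom.ofRel R).measure = (Polyhom.ofRel S).measure) : R = S := by
  refine eq_of_rel_eq_of_alpha_eq hrel (S.isAlpha_unique ?_ S.isAlpha_alpha)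
  have key : ∀ Q : HaarRelation γ η,
      (Polyhom.ofRel Q).measure.map Prod.fst = Q.haar.map (fun r : Q.rel => (r : G × H).1) := by
    intro Q
    rw [Polyhom.measure, Measure.map_map measurable_fst measurable_subtype_coe]
    rfl
  unfold IsAlpha
  rw [← key S, ← h, key R, ← hrel]
  exact R.isAlpha_alpha

namespace Polyhom

theorem comp_ofRel_eq {T : HaarRelation η κ} {R : HaarRelation γ η} {S : HaarRelation γ κ}
    (h : HaarRelation.IsProduct T R S) : (ofRel T).comp (ofRel R) = ofRel S := by
  have hex : ∃ S, HaarRelation.IsProduct T R S := ⟨S, h⟩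
  rw [comp, dif_pos hex, HaarRelation.eq_of_rel_eq_of_alpha_eq
    (hex.choose_spec.rel_eq.trans h.rel_eq.symm) (hex.choose_spec.alpha_eq.trans h.alpha_eq.symm)]

theorem comp_zero (T : Polyhom η κ) : T.comp (zero : Polyhom γ η) = zero := by
  cases T <;> rfl

theorem toPolymorphism_comp (T : Polyhom η κ) (R : Polyhom γ η) :
    (T.comp R).toPolymorphism = T.toPolymorphism.comp R.toPolymorphism := by
  ext1
  cases T with
  | zero =>
    rw [Polymorphism.comp_measure_of_left_eq_zero _ rfl]
    rfl
  | ofRel T =>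
    cases R with
    | zero =>
      rw [Polymorphism.comp_measure_of_right_eq_zero _ rfl]
      rfl
    | ofRel R =>
      obtain ⟨S, hS, hm⟩ := HaarRelation.exists_isProduct T R
      rw [comp_ofRel_eq hS, ← hm]
      rfl

/-- For nonzero factors both sides have the same relation, and the same measure by the
associativity of the product of polymorphisms. -/
theorem comp_assoc {L : Type*} [Group L] [TopologicalSpace L] [IsTopologicalGroup L] [T2Space L]
    [LocallyCompactSpace L] [SecondCountableTopology L] [MeasurableSpace L] [BorelSpace L]
    {l : Measure L} [l.IsHaarMeasure] (S : Polyhom κ l) (T : Polyhom η κ) (R : Polyhom γ η) :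
    (S.comp T).comp R = S.comp (T.comp R) := by
  cases R with
  | zero => simp only [comp_zero]
  | ofRel R =>
    cases T with
    | zero =>
      rw [comp_zero]
      exact (comp_zero S).symm
    | ofRel T =>
      cases S with
      | zero => rfl
      | ofRel S =>
        obtain ⟨TR, hTR, -⟩ := HaarRelation.exists_isProduct T R
        obtain ⟨ST, hST, -⟩ := HaarRelation.exists_isProduct S T
        obtain ⟨U, hU, hUm⟩ := HaarRelation.exists_isProduct ST R
        obtain ⟨V, hV, hVm⟩ := HaarRelation.exists_isProduct S TR
        rw [comp_ofRel_eq hST, comp_ofRel_eq hTR, comp_ofRel_eq hU, comp_ofRel_eq hV]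
        congr 1
        refine HaarRelation.eq_of_rel_eq_of_measure_eq ?_ ?_
        · rw [hU.rel_eq, hV.rel_eq, hST.rel_eq, hTR.rel_eq, MultRel.comp_assoc]
        · rw [hUm, hVm, ← comp_ofRel_eq hST, ← comp_ofRel_eq hTR, toPolymorphism_comp,
            toPolymorphism_comp, Polymorphism.comp_assoc]

end Polyhom

end

theorem mainTheorem1
    {G H K L : Type*}
    [Group G] [TopologicalSpace G] [IsTopologicalGroup G] [T2Space G] [LocallyCompactSpace G]
    [SecondCountableTopology G] [MeasurableSpace G] [BorelSpace G]
    [Group H] [TopologicalSpace H] [IsTopologicalGroup H] [T2Space H] [LocallyCompactSpace H]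
    [SecondCountableTopology H] [MeasurableSpace H] [BorelSpace H]
    [Group K] [TopologicalSpace K] [IsTopologicalGroup K] [T2Space K] [LocallyCompactSpace K]
    [SecondCountableTopology K] [MeasurableSpace K] [BorelSpace K]
    [Group L] [TopologicalSpace L] [IsTopologicalGroup L] [T2Space L] [LocallyCompactSpace L]
    [SecondCountableTopology L] [MeasurableSpace L] [BorelSpace L]
    -- unimodular groups with fixed Haar measures
    (γ : Measure G) [γ.IsHaarMeasure] [γ.IsMulRightInvariant]
    (η : Measure H) [η.IsHaarMeasure] [η.IsMulRightInvariant]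
    (κ : Measure K) [κ.IsHaarMeasure] [κ.IsMulRightInvariant]
    (l : Measure L) [l.IsHaarMeasure] [l.IsMulRightInvariant] :
    -- every polyhomomorphism is a polymorphism
    (∀ R : Polyhom γ η,
      R.measure.map Prod.fst ≤ γ ∧ R.measure.map Prod.snd ≤ η ∧
        R.toPolymorphism.measure = R.measure) ∧
    -- the constants `α`, `β` of a nonzero polyhomomorphism are well defined
    (∀ R : HaarRelation γ η,
      (R.IsAlpha R.alpha ∧ (∀ a, R.IsAlpha a → a = R.alpha) ∧ 0 < R.alpha ∧ R.alpha ≤ 1) ∧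
      (R.IsBeta R.beta ∧ (∀ b, R.IsBeta b → b = R.beta) ∧ 0 < R.beta ∧ R.beta ≤ 1)) ∧
    -- the product of nonzero polyhomomorphisms is well defined: the indices are finite, and
    -- there is exactly one `S` with `S = T R` as a relation and with the given normalisations
    (∀ (T : HaarRelation η κ) (R : HaarRelation γ η),
      (MultRel.indef R.rel ⊓ MultRel.dom T.rel).relIndex (MultRel.indef R.rel) ≠ 0 ∧
      (MultRel.ker T.rel ⊓ MultRel.im R.rel).relIndex (MultRel.ker T.rel) ≠ 0 ∧
      ∃ S : HaarRelation γ κ,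
        (Polyhom.ofRel T).comp (Polyhom.ofRel R) = Polyhom.ofRel S ∧
        HaarRelation.IsProduct T R S ∧
        ∀ S' : HaarRelation γ κ, HaarRelation.IsProduct T R S' → S' = S) ∧
    -- the product of polyhomomorphisms is the product of polymorphisms
    (∀ (T : Polyhom η κ) (R : Polyhom γ η),
      (T.comp R).toPolymorphism = T.toPolymorphism.comp R.toPolymorphism) ∧
    -- the product is associative
    (∀ (S : Polyhom κ l) (T : Polyhom η κ) (R : Polyhom γ η),
      (S.comp T).comp R = S.comp (T.comp R)) := by
  refine ⟨fun R => ⟨R.toPolymorphism.fst_le, R.toPolymorphism.snd_le, rfl⟩,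
    fun R => ⟨⟨R.isAlpha_alpha, fun a ha => R.isAlpha_unique ha R.isAlpha_alpha, R.alpha_mem⟩,
      ⟨R.isBeta_beta, fun b hb => R.isBeta_unique hb R.isBeta_beta, R.beta_mem⟩⟩,
    fun T R => ⟨?_, ?_, ?_⟩, Polyhom.toPolymorphism_comp, Polyhom.comp_assoc⟩
  · rw [Subgroup.inf_relIndex_left]
    exact R.relIndex_indef_ne_zero T.isOpen_dom
  · rw [Subgroup.inf_relIndex_left]
    exact T.relIndex_ker_ne_zero R.isOpen_im
  · obtain ⟨S, hS, -⟩ := HaarRelation.exists_isProduct T R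
    exact ⟨S, Polyhom.comp_ofRel_eq hS, hS, fun S' hS' =>
      HaarRelation.eq_of_rel_eq_of_alpha_eq (hS'.rel_eq.trans hS.rel_eq.symm)
        (hS'.alpha_eq.trans hS.alpha_eq.symm)⟩
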